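/- Let $\{\xi(m)\}_{m\in\mathbb Z}$ and $\{\eta(m)\}_{m\in\mathbb Z}$ be mutually uncorrelated, centred, wide-sense stationary sequences of complex random variables with finite second moments and with spectral densities $f,g\ge 0$ (integrable on $[-\pi,\pi)$), i.e. $\mathsf E\,\xi(m)\overline{\xi(n)}=\frac1{2\pi}\int_{-\pi}^{\pi}e^{i(m-n)\lambda}f(\lambda)\,d\lambda$, likewise for $\eta$ with $g$, and $\mathsf E\,\xi(m)\overline{\eta(n)}=0$ for all $m,n$. Suppose that the minimality condition $\int_{-\pi}^{\pi}\frac{d\lambda}{f(\lambda)+g(\lambda)}<\infty$ holds. Put $$r(k)=\frac1{2\pi}\int_{-\pi}^{\pi}e^{-ik\lambda}\frac{f(\lambda)}{f(\lambda)+g(\lambda)}\,d\lambda,\qquad g(k)=\frac1{2\pi}\int_{-\pi}^{\pi}e^{-ik\lambda}g(\lambda)\,d\lambda,\qquad P_{k,j}=\frac1{2\pi}\int_{-\pi}^{\pi}\frac{e^{i\lambda(j-k)}}{f(\lambda)+g(\lambda)}\,d\lambda\qquad(k,j\in\mathbb Z),$$ and suppose that the matrix $(P_{k,j})_{k,j\ge0}$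 defines an invertible linear operator $\mathbf P$ in $\ell_2$ (that is, $(\mathbf Px)_k=\sum_{j\ge0}P_{k,j}x_j$ converges for all $x\in\ell_2$, and $\mathbf P$ is a bijection of $\ell_2$ onto itself). Let $\mathbf V=\mathbf P^{-1}$, with matrix elements $V_{k,j}=(\mathbf Ve_j)_k$, $k,j\ge0$. Then $\mathbf V$ is given by the matrix $(V_{k,j})$, the vector $\mathbf r_0=(r(1),r(2),r(3),\dots)$ belongs to $\ell_2$, and the matrix $(\mathbf Y)_{k,l}=P_{-k,\,l+1}$, $k,l\ge0$, defines a linear operator $\mathbf Y$ in $\ell_2$. Let $\widehat\xi(0)$ be the mean-square optimal linear estimate of $\xi(0)$ based on the observations $\xi(m)+\eta(m)$, $m=0,-1,-2,\dots$, i.e. the orthogonal projection of $\xi(0)$ in $L_2$ on the closed linear span of these observations. Then $$\widehat\xi(0)=\sum_{k=0}^{\infty}\bigl(\overline{r(k)}-(\mathbf Y\mathbf V\mathbf r_0)_k\bigr)\bigl(\xi(-k)+\eta(-k)\bigr),$$ where the series converges in mean square, and the mean-square error is $$\mathsf E\,|\xi(0)-\widehat\xi(0)|^2=\sum_{j=0}^{\infty}\sum_{k=0}^{\infty}\overline{V_{k,j}}\;\overline{r(j+1)}\;r(k+1)+\sum_{l\in\mathbb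 Z}r(l)\,g(-l),$$ where all the series converge (the double sum as an iterated one). -/

import Mathlib

open MeasureTheory

noncomputable section

/-- The Fourier coefficient `(1/2π) ∫_{-π}^{π} e^{-i n t} φ(t) dt`, so that `φ ~ ∑ φ(n) e^{i n t}`. -/
def fourierCoef (φ : ℝ → ℝ) (n : ℤ) : ℂ :=
  (1 / (2 * Real.pi) : ℂ) *
    ∫ t in (-Real.pi)..Real.pi, Complex.exp (-(Complex.I * n * t)) * (φ t : ℂ)

/-- The explicit integral is Mathlib's Fourier coefficient on `[-π, π]`. -/
theorem fourierCoef_eq_fourierCoeffOn (φ : ℝ → ℝ) (n : ℤ) :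
    fourierCoef φ n =
      fourierCoeffOn (neg_lt_self Real.pi_pos) (fun t => (φ t : ℂ)) n := by
  have hpi : (Real.pi : ℂ) ≠ 0 := by exact_mod_cast Real.pi_ne_zero
  rw [fourierCoeffOn_eq_integral, fourierCoef, Complex.real_smul]
  congr 1
  · push_cast
    ring
  · refine intervalIntegral.integral_congr fun t _ => ?_
    simp only [fourier_coe_apply, smul_eq_mul]
    congr 2
    push_cast
    field_simp
    ring

variable {Ω : Type*} [MeasurableSpace Ω] {μ : Measure Ω}

/-- `ξ` is a (wide sense) stationary sequence of square-integrable centred complex random variables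
whose spectral function is absolutely continuous with spectral density `f` on `[-π, π)`, in the
normalization `E ξ(m) conj(ξ(n)) = (1/2π) ∫_{-π}^{π} e^{i(m-n)t} f(t) dt`. -/
structure IsStationaryWithDensity (ξ : ℤ → Lp ℂ 2 μ) (f : ℝ → ℝ) : Prop where
  nonneg : ∀ᵐ t ∂(volume.restrict (Set.Ico (-Real.pi) Real.pi)), 0 ≤ f t
  integrable : IntegrableOn f (Set.Ico (-Real.pi) Real.pi)
  mean_zero : ∀ m : ℤ, ∫ ω, ξ m ω ∂μ = 0
  covariance : ∀ m n : ℤ, ∫ ω, ξ m ω * (starRingEnd ℂ) (ξ n ω) ∂μ =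
    (1 / (2 * Real.pi) : ℂ) *
      ∫ t in (-Real.pi)..Real.pi, Complex.exp (Complex.I * (m - n : ℤ) * t) * (f t : ℂ)

/-- The sequences `ξ` and `η` (of centred variables) are mutually uncorrelated. -/
def AreUncorrelated (ξ η : ℤ → Lp ℂ 2 μ) : Prop :=
  ∀ m n : ℤ, ∫ ω, ξ m ω * (starRingEnd ℂ) (η n ω) ∂μ = 0

/-- The minimality condition `∫_{-π}^{π} dt / (f(t) + g(t)) < ∞`, where `1 / 0 = ∞`. -/
def MinimalityCondition (f g : ℝ → ℝ) : Prop :=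
  ∫⁻ t in Set.Ico (-Real.pi) Real.pi, (ENNReal.ofReal (f t + g t))⁻¹ < ⊤

/-- The closed linear subspace of `L²` generated by `ξ(m) + η(m)`, `m = 0, -1, -2, …`. -/
def observedSpace (ξ η : ℤ → Lp ℂ 2 μ) : Submodule ℂ (Lp ℂ 2 μ) :=
  (Submodule.span ℂ {Z | ∃ m : ℤ, m ≤ 0 ∧ Z = ξ m + η m}).topologicalClosure

/-- The observed space is closed in the complete space `L²`. -/
instance observedSpace_completeSpace (ξ η : ℤ → Lp ℂ 2 μ) :
    CompleteSpace (observedSpace ξ η) :=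
  (Submodule.isClosed_topologicalClosure _).completeSpace_coe

/-- The mean-square optimal linear estimate of `Z` from the observations `ξ(m) + η(m)`, `m ≤ 0`:
the orthogonal projection of `Z` on the observed space. -/
def optimalEstimate (ξ η : ℤ → Lp ℂ 2 μ) (Z : Lp ℂ 2 μ) : Lp ℂ 2 μ :=
  (observedSpace ξ η).starProjection Z

/-- The mean-square error `E |Z - W|²`. -/
def meanSquareError (Z W : Lp ℂ 2 μ) : ℝ := ∫ ω, ‖Z ω - W ω‖ ^ 2 ∂μ

/-- The space `ℓ²` of square-summable complex sequences indexed by `k = 0, 1, 2, …`. -/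
abbrev EllTwo : Type := lp (fun _ : ℕ => ℂ) 2

/-- `T` is the linear operator in `ℓ²` defined by the matrix `M`:
`(T x)_k = ∑_j M_{k,j} x_j` for every `x` in `ℓ²`, the series being convergent. -/
def IsMatrixOperator (M : ℕ → ℕ → ℂ) (T : EllTwo →ₗ[ℂ] EllTwo) : Prop :=
  ∀ (x : EllTwo) (k : ℕ), HasSum (fun j : ℕ => M k j * x j) (T x k)

/-- The element `T_{k,j}` of the matrix of an operator: the `k`th coordinate of `T e_j`. -/
def matrixElement (T : EllTwo →ₗ[ℂ] EllTwo) (k j : ℕ) : ℂ :=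
  T (lp.single 2 j (1 : ℂ)) k

/-- `P_{k,j} = (1/2π) ∫_{-π}^{π} e^{i(j-k)t} / (f(t) + g(t)) dt`, for integers `k`, `j`. -/
def coefP (f g : ℝ → ℝ) (k j : ℤ) : ℂ := fourierCoef (fun t => 1 / (f t + g t)) (k - j)

/-- `r(k)`, the Fourier coefficients of `f / (f + g)`. -/
def coefR (f g : ℝ → ℝ) (k : ℤ) : ℂ := fourierCoef (fun t => f t / (f t + g t)) k

end

section MatrixOperators

theorem inner_single_one_left (k : ℕ) (x : EllTwo) :
    inner ℂ (lp.single 2 k (1 : ℂ) : EllTwo) x = x k := by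
  rw [lp.inner_single_left]
  simp

theorem inner_single_one_right (k : ℕ) (x : EllTwo) :
    inner ℂ x (lp.single 2 k (1 : ℂ) : EllTwo) = starRingEnd ℂ (x k) := by
  rw [lp.inner_single_right]
  simp

theorem hasSum_single_one (x : EllTwo) :
    HasSum (fun k : ℕ => x k • (lp.single 2 k (1 : ℂ) : EllTwo)) x := by
  refine (lp.hasSum_single (p := 2) (by norm_num) x).congr_fun fun k => ?_
  rw [← lp.single_smul]
  simp

theorem IsMatrixOperator.apply_single {M : ℕ → ℕ → ℂ} {T : EllTwo →ₗ[ℂ] EllTwo}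
    (hT : IsMatrixOperator M T) (k j : ℕ) : T (lp.single 2 j (1 : ℂ)) k = M k j := by
  refine (hT _ k).unique ?_
  convert hasSum_single (f := fun i => M k i * (lp.single 2 j (1 : ℂ) : EllTwo) i) j ?_ using 1
  · simp
  · intro i hi
    simp [hi]

/-- Two continuous functionals agreeing on the standard basis of `ℓ²` agree. -/
theorem ellTwo_functional_ext {F : Type*} [NormedAddCommGroup F] [NormedSpace ℂ F]
    {φ ψ : EllTwo →L[ℂ] F}
    (h : ∀ k : ℕ, φ (lp.single 2 k (1 : ℂ)) = ψ (lp.single 2 k (1 : ℂ))) : φ = ψ := by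
  ext x
  refine (φ.hasSum (hasSum_single_one x)).unique ?_
  convert ψ.hasSum (hasSum_single_one x) using 2 with k
  simp [h]

/-- A linear operator in `ℓ²` defined by a Hermitian matrix is symmetric. -/
theorem IsMatrixOperator.isSymmetric {M : ℕ → ℕ → ℂ} {T : EllTwo →ₗ[ℂ] EllTwo}
    (hT : IsMatrixOperator M T) (hM : ∀ k j, M k j = starRingEnd ℂ (M j k)) : T.IsSymmetric := by
  have hrow : ∀ (k : ℕ) (x : EllTwo), T x k = inner ℂ (T (lp.single 2 k (1 : ℂ))) x := by
    intro k x
    refine (hT x k).unique ?_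
    refine (lp.hasSum_inner (T (lp.single 2 k (1 : ℂ))) x).congr_fun fun j => ?_
    rw [hT.apply_single, hM k j]
    simp [mul_comm]
  have hcont : Continuous T := by
    refine T.continuous_of_seq_closed_graph fun u x y hu hTu => ?_
    refine lp.ext (funext fun k => ?_)
    rw [hrow]
    refine tendsto_nhds_unique (f := fun n => T (u n) k) (l := Filter.atTop) ?_ ?_
    · rw [← inner_single_one_left]
      simp_rw [← inner_single_one_left k (T _)]
      exact tendsto_const_nhds.inner hTu
    · simp_rw [hrow]
      exact tendsto_const_nhds.inner hu
  intro x y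
  let A : EllTwo →L[ℂ] EllTwo := ⟨T, hcont⟩
  have key : innerSL ℂ (A x) = (innerSL ℂ x).comp A := by
    refine ellTwo_functional_ext fun k => ?_
    rw [innerSL_apply_apply, ContinuousLinearMap.comp_apply, innerSL_apply_apply,
      inner_single_one_right, ← inner_conj_symm x]
    congr 1
    exact hrow k x
  exact DFunLike.congr_fun key y

theorem LinearMap.IsSymmetric.isMatrixOperator_matrixElement {T : EllTwo →ₗ[ℂ] EllTwo}
    (hT : T.IsSymmetric) : IsMatrixOperator (matrixElement T) T := by
  intro x k
  rw [← inner_single_one_left, ← hT]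
  refine (lp.hasSum_inner (T (lp.single 2 k (1 : ℂ))) x).congr_fun fun j => ?_
  rw [matrixElement, ← inner_single_one_left, ← hT, inner_single_one_right]
  simp [mul_comm]

theorem LinearMap.IsSymmetric.symm {E : Type*} [NormedAddCommGroup E] [InnerProductSpace ℂ E]
    (A : E ≃ₗ[ℂ] E) (hA : A.toLinearMap.IsSymmetric) : A.symm.toLinearMap.IsSymmetric := by
  intro x y
  have := hA (A.symm x) (A.symm y)
  simpa using this.symm

/-- A positive symmetric bijective operator in a Hilbert space is bounded and bounded below. -/
theorem LinearMap.IsSymmetric.exists_bounds {E : Type*} [NormedAddCommGroup E]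
    [InnerProductSpace ℂ E] [CompleteSpace E] (A : E ≃ₗ[ℂ] E) (hA : A.toLinearMap.IsSymmetric)
    (hpos : ∀ x, 0 ≤ (inner ℂ x (A x)).re) :
    ∃ c > 0, ∃ C > 0, ∀ x, c * ‖x‖ ^ 2 ≤ (inner ℂ x (A x)).re ∧
      (inner ℂ x (A x)).re ≤ C * ‖x‖ ^ 2 := by
  let B : E →L[ℂ] E := ⟨A.toLinearMap, hA.continuous⟩
  let B' : E →L[ℂ] E := ⟨A.symm.toLinearMap, (LinearMap.IsSymmetric.symm A hA).continuous⟩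
  set K := ‖B‖ + 1 with hK
  set K' := ‖B'‖ + 1 with hK'
  have hK0 : 0 < K := by positivity
  have hK0' : 0 < K' := by positivity
  have hup : ∀ x, (inner ℂ x (A x)).re ≤ K * ‖x‖ ^ 2 := by
    intro x
    calc (inner ℂ x (A x)).re ≤ ‖x‖ * ‖B x‖ := re_inner_le_norm (𝕜 := ℂ) x (B x)
      _ ≤ ‖x‖ * (K * ‖x‖) := by
        gcongr
        exact (B.le_opNorm x).trans (by gcongr; linarith)
      _ = K * ‖x‖ ^ 2 := by ring
  have hlow : ∀ x, ‖A x‖ ^ 2 ≤ K * (inner ℂ x (A x)).re := by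
    intro x
    have h1 := hpos ((K : ℂ) • x - A x)
    have h2 := hup (A x)
    have h3 : inner ℂ x (A (A x)) = inner ℂ (A x) (A x) := (hA x (A x)).symm
    rw [map_sub, map_smul, inner_sub_left, inner_sub_right, inner_sub_right, inner_smul_left,
      inner_smul_left, inner_smul_right, inner_smul_right, h3] at h1
    simp only [Complex.conj_ofReal, Complex.sub_re, Complex.re_ofReal_mul] at h1
    have h4 : (inner ℂ (A x) (A x)).re = ‖A x‖ ^ 2 := inner_self_eq_norm_sq (𝕜 := ℂ) (A x)
    rw [h4] at h1
    have h5 : 0 ≤ K * (K * (inner ℂ x (A x)).re - ‖A x‖ ^ 2) := by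
      linarith
    linarith [nonneg_of_mul_nonneg_right h5 hK0]
  refine ⟨(K * K' ^ 2)⁻¹, by positivity, K, hK0, fun x => ⟨?_, hup x⟩⟩
  rw [inv_mul_le_iff₀ (by positivity)]
  have h4 : ‖x‖ ≤ K' * ‖A x‖ := by
    calc ‖x‖ = ‖B' (A x)‖ := by simp [B']
      _ ≤ K' * ‖A x‖ := (B'.le_opNorm _).trans (by gcongr; linarith)
  calc ‖x‖ ^ 2 ≤ (K' * ‖A x‖) ^ 2 := by gcongr
    _ = K' ^ 2 * ‖A x‖ ^ 2 := by ring
    _ ≤ K' ^ 2 * (K * (inner ℂ x (A x)).re) := by gcongr; exact hlow x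
    _ = _ := by ring

end MatrixOperators

section CircleDensities

open scoped ENNReal NNReal

variable {T : ℝ} [hT : Fact (0 < T)]

theorem norm_toLp_two_sq {X : Type*} [TopologicalSpace X] [CompactSpace X] [MeasurableSpace X]
    [BorelSpace X] (ν : Measure X) [IsFiniteMeasure ν] (φ : C(X, ℂ)) :
    ‖ContinuousMap.toLp (E := ℂ) 2 ν ℂ φ‖ ^ 2 = ∫ t, ‖φ t‖ ^ 2 ∂ν := by
  have h := L2.inner_def (𝕜 := ℂ) (ContinuousMap.toLp (E := ℂ) 2 ν ℂ φ)
    (ContinuousMap.toLp (E := ℂ) 2 ν ℂ φ)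
  rw [inner_self_eq_norm_sq_to_K] at h
  have h2 : ∫ a, inner ℂ (ContinuousMap.toLp (E := ℂ) 2 ν ℂ φ a)
      (ContinuousMap.toLp (E := ℂ) 2 ν ℂ φ a) ∂ν = ∫ t, ((‖φ t‖ ^ 2 : ℝ) : ℂ) ∂ν := by
    refine integral_congr_ae ?_
    filter_upwards [ContinuousMap.coeFn_toLp (p := 2) (𝕜 := ℂ) ν φ] with t ht
    rw [ht, inner_self_eq_norm_sq_to_K]
    push_cast
    rfl
  rw [h2, integral_complex_ofReal] at h
  exact Complex.ofReal_injective ((Complex.ofReal_pow _ _).trans h)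

/-- Finite measures on the circle are compared by their values on squared moduli of trigonometric
polynomials. -/
theorem measure_le_of_forall_integral_sq_le (ν₁ ν₂ : Measure (AddCircle T)) [IsFiniteMeasure ν₁]
    [IsFiniteMeasure ν₂]
    (h : ∀ q ∈ Submodule.span ℂ (Set.range (@fourier T)),
      ∫ t, ‖q t‖ ^ 2 ∂ν₁ ≤ ∫ t, ‖q t‖ ^ 2 ∂ν₂) : ν₁ ≤ ν₂ := by
  have hall : ∀ φ : C(AddCircle T, ℂ), ∫ t, ‖φ t‖ ^ 2 ∂ν₁ ≤ ∫ t, ‖φ t‖ ^ 2 ∂ν₂ := by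
    intro φ
    have hclosed : IsClosed {φ : C(AddCircle T, ℂ) |
        ∫ t, ‖φ t‖ ^ 2 ∂ν₁ ≤ ∫ t, ‖φ t‖ ^ 2 ∂ν₂} := by
      simp_rw [← norm_toLp_two_sq]
      exact isClosed_le (by fun_prop) (by fun_prop)
    have hsub := closure_minimal (fun q hq => h q hq) hclosed
    refine hsub ?_
    rw [← Submodule.topologicalClosure_coe, span_fourier_closure_eq_top]
    trivial
  have hcont : ∀ b : BoundedContinuousFunction (AddCircle T) ℝ≥0,
      ∫⁻ t, b t ∂ν₁ ≤ ∫⁻ t, b t ∂ν₂ := by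
    intro b
    let φ : C(AddCircle T, ℂ) := ⟨fun t => ((NNReal.sqrt (b t) : ℝ) : ℂ), by fun_prop⟩
    have hφ : ∀ t, ‖φ t‖ ^ 2 = b t := by
      intro t
      simp [φ]
    have hb := hall φ
    simp_rw [hφ] at hb
    have hi : ∀ (ν : Measure (AddCircle T)) [IsFiniteMeasure ν],
        ∫⁻ t, b t ∂ν = ENNReal.ofReal (∫ t, (b t : ℝ) ∂ν) := by
      intro ν _
      rw [ofReal_integral_eq_lintegral_ofReal]
      · simp
      · exact (b.integrable_of_nnreal ν)
      · exact Filter.Eventually.of_forall fun t => NNReal.coe_nonneg _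
    rw [hi, hi]
    exact ENNReal.ofReal_le_ofReal hb
  have hcl : ∀ K : Set (AddCircle T), IsClosed K → ν₁ K ≤ ν₂ K := fun K hK =>
    le_of_tendsto_of_tendsto' (HasOuterApproxClosed.tendsto_lintegral_apprSeq hK ν₁)
      (HasOuterApproxClosed.tendsto_lintegral_apprSeq hK ν₂) fun n => hcont _
  refine Measure.le_iff.2 fun s hs => ?_
  rw [hs.measure_eq_iSup_isClosed_of_ne_top (measure_ne_top _ _)]
  exact iSup_le fun K => iSup_le fun hKs => iSup_le fun hK => (hcl K hK).trans (measure_mono hKs)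

theorem ae_le_of_forall_integral_mul_sq_le {m : Measure (AddCircle T)} [IsFiniteMeasure m]
    {w₁ w₂ : AddCircle T → ℝ}
    (hw₁ : Integrable w₁ m) (hw₂ : Integrable w₂ m) (h₁ : 0 ≤ᵐ[m] w₁) (h₂ : 0 ≤ᵐ[m] w₂)
    (h : ∀ q ∈ Submodule.span ℂ (Set.range (@fourier T)),
      ∫ t, w₁ t * ‖q t‖ ^ 2 ∂m ≤ ∫ t, w₂ t * ‖q t‖ ^ 2 ∂m) : w₁ ≤ᵐ[m] w₂ := by
  have hd : ∀ w : AddCircle T → ℝ, Integrable w m → 0 ≤ᵐ[m] w → ∀ q : C(AddCircle T, ℂ),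
      ∫ t, ‖q t‖ ^ 2 ∂(m.withDensity fun t => ENNReal.ofReal (w t)) =
        ∫ t, w t * ‖q t‖ ^ 2 ∂m := by
    intro w hw h0 q
    rw [integral_withDensity_eq_integral_toReal_smul₀ hw.aemeasurable.ennreal_ofReal
      (Filter.Eventually.of_forall fun _ => ENNReal.ofReal_lt_top)]
    refine integral_congr_ae ?_
    filter_upwards [h0] with t ht
    rw [ENNReal.toReal_ofReal ht, smul_eq_mul]
  have hf : ∀ w : AddCircle T → ℝ, Integrable w m →
      IsFiniteMeasure (m.withDensity fun t => ENNReal.ofReal (w t)) := fun w hw =>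
    isFiniteMeasure_withDensity_ofReal hw.2
  have := hf w₁ hw₁
  have := hf w₂ hw₂
  have hle := measure_le_of_forall_integral_sq_le (T := T)
    (m.withDensity fun t => ENNReal.ofReal (w₁ t)) (m.withDensity fun t => ENNReal.ofReal (w₂ t))
    fun q hq => by rw [hd w₁ hw₁ h₁, hd w₂ hw₂ h₂]; exact h q hq
  have hae := ae_le_of_forall_setLIntegral_le_of_sigmaFinite₀ (μ := m)
    (f := fun t => ENNReal.ofReal (w₁ t)) (g := fun t => ENNReal.ofReal (w₂ t))
    hw₁.aemeasurable.ennreal_ofReal fun s hs _ => by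
      rw [← withDensity_apply _ hs, ← withDensity_apply _ hs]
      exact hle s
  filter_upwards [hae, h₂] with t ht ht2
  exact (ENNReal.ofReal_le_ofReal_iff ht2).1 ht

end CircleDensities

section ToeplitzBounds

open AddCircle

variable {T : ℝ} [hT : Fact (0 < T)]

theorem fourierCoeff_ofReal_neg (w : AddCircle T → ℝ) (n : ℤ) :
    fourierCoeff (fun t => (w t : ℂ)) (-n) =
      starRingEnd ℂ (fourierCoeff (fun t => (w t : ℂ)) n) := by
  rw [fourierCoeff, fourierCoeff, ← integral_conj]
  refine integral_congr_ae (Filter.Eventually.of_forall fun t => ?_)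
  simp

theorem fourierCoeff_one (n : ℤ) :
    fourierCoeff (fun _ : AddCircle T => ((1 : ℝ) : ℂ)) n = if n = 0 then 1 else 0 := by
  have h := fourierCoeff_fourier (T := T) 0
  have h2 : (fun _ : AddCircle T => ((1 : ℝ) : ℂ)) = fourier 0 := by
    ext t
    simp
  rw [h2, h, Pi.single_apply]

theorem integral_mul_norm_sq_sum_fourier {ι : Type*} {w : AddCircle T → ℝ}
    (hw : Integrable w haarAddCircle) (s : Finset ι) (b : ι → ℂ) (n : ι → ℤ) :
    ((∫ t, w t * ‖(∑ i ∈ s, b i • @fourier T (n i)) t‖ ^ 2 ∂haarAddCircle : ℝ) : ℂ) =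
      ∑ i ∈ s, ∑ j ∈ s, starRingEnd ℂ (b i) * b j *
        fourierCoeff (fun t => (w t : ℂ)) (n i - n j) := by
  have hpt : ∀ t : AddCircle T, ((w t * ‖(∑ i ∈ s, b i • @fourier T (n i)) t‖ ^ 2 : ℝ) : ℂ) =
      ∑ i ∈ s, ∑ j ∈ s, starRingEnd ℂ (b i) * b j *
        (fourier (-(n i - n j)) t • (w t : ℂ)) := by
    intro t
    push_cast
    rw [← Complex.conj_mul', ContinuousMap.sum_apply, map_sum, Finset.sum_mul_sum, Finset.mul_sum]
    refine Finset.sum_congr rfl fun i _ => ?_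
    rw [Finset.mul_sum]
    refine Finset.sum_congr rfl fun j _ => ?_
    rw [neg_sub, sub_eq_neg_add, fourier_add, fourier_neg]
    simp only [ContinuousMap.smul_apply, smul_eq_mul, map_mul]
    ring
  rw [← integral_complex_ofReal]
  simp_rw [hpt]
  have hi : ∀ i j, Integrable (fun t => starRingEnd ℂ (b i) * b j *
      (fourier (-(n i - n j)) t • (w t : ℂ))) (@haarAddCircle T _) := fun i j =>
    (hw.ofReal.fourier_smul _).const_mul _
  rw [integral_finsetSum _ fun i _ => integrable_finsetSum _ fun j _ => hi i j]
  refine Finset.sum_congr rfl fun i _ => ?_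
  rw [integral_finsetSum _ fun j _ => hi i j]
  refine Finset.sum_congr rfl fun j _ => ?_
  rw [integral_const_mul]
  rfl

/-- The quadratic form of a Toeplitz operator on a finite sequence. -/
theorem IsMatrixOperator.inner_sum_single {w : AddCircle T → ℝ} (hw : Integrable w haarAddCircle)
    {A : EllTwo →ₗ[ℂ] EllTwo}
    (hA : IsMatrixOperator (fun k j : ℕ => fourierCoeff (fun t => (w t : ℂ)) ((k : ℤ) - j)) A)
    {ι : Type*} (s : Finset ι) (b : ι → ℂ) (n : ι → ℕ) (N : ℤ) :
    inner ℂ (∑ i ∈ s, b i • (lp.single 2 (n i) (1 : ℂ) : EllTwo))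
      (A (∑ i ∈ s, b i • (lp.single 2 (n i) (1 : ℂ) : EllTwo))) =
      ((∫ t, w t * ‖(∑ i ∈ s, b i • @fourier T (n i - N)) t‖ ^ 2 ∂haarAddCircle : ℝ) : ℂ) := by
  rw [integral_mul_norm_sq_sum_fourier hw, sum_inner]
  refine Finset.sum_congr rfl fun i _ => ?_
  rw [map_sum, inner_sum]
  refine Finset.sum_congr rfl fun j _ => ?_
  rw [map_smul, inner_smul_left, inner_smul_right, inner_single_one_left, hA.apply_single,
    sub_sub_sub_cancel_right, mul_assoc]

theorem norm_sum_single_sq {ι : Type*} (s : Finset ι) (b : ι → ℂ) (n : ι → ℕ) (N : ℤ) :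
    ‖∑ i ∈ s, b i • (lp.single 2 (n i) (1 : ℂ) : EllTwo)‖ ^ 2 =
      ∫ t, ‖(∑ i ∈ s, b i • @fourier T (n i - N)) t‖ ^ 2 ∂haarAddCircle := by
  have hid : IsMatrixOperator (fun k j : ℕ =>
      fourierCoeff (fun _ : AddCircle T => ((1 : ℝ) : ℂ)) ((k : ℤ) - j)) LinearMap.id := by
    intro x k
    simp_rw [fourierCoeff_one]
    refine (hasSum_ite_eq k (x k)).congr_fun fun j => ?_
    by_cases h : j = k
    · simp [h]
    · have h' : (k : ℤ) - j ≠ 0 := by omega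
      simp [h, h']
  have h := hid.inner_sum_single (integrable_const 1) s b n N
  simp only [one_mul, LinearMap.id_apply] at h
  rw [inner_self_eq_norm_sq_to_K] at h
  exact Complex.ofReal_injective ((Complex.ofReal_pow _ _).trans h)

theorem exists_eq_sum_fourier {S : ℝ} {q : C(AddCircle S, ℂ)}
    (hq : q ∈ Submodule.span ℂ (Set.range (@fourier S))) :
    ∃ (s : Finset ℤ) (b : ℤ → ℂ) (n : ℤ → ℕ) (N : ℤ),
      q = ∑ i ∈ s, b i • @fourier S (n i - N) := by
  obtain ⟨a, rfl⟩ := Finsupp.mem_span_range_iff_exists_finsupp.1 hq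
  refine ⟨a.support, a, fun i => (i + ∑ l ∈ a.support, |l|).toNat, ∑ l ∈ a.support, |l|, ?_⟩
  refine Finset.sum_congr rfl fun i hi => ?_
  have h1 : |i| ≤ ∑ l ∈ a.support, |l| :=
    Finset.single_le_sum (f := fun l : ℤ => |l|) (fun l _ => abs_nonneg l) hi
  have h2 := neg_abs_le i
  rw [Int.toNat_of_nonneg (by linarith), add_sub_cancel_right]

/-- If the Toeplitz matrix of a nonnegative integrable symbol defines an invertible operator in
`ℓ²`, then the symbol is bounded and bounded away from zero. -/
theorem IsMatrixOperator.toeplitz_symbol_bounds {p : AddCircle T → ℝ}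
    (hp : Integrable p haarAddCircle) (h0 : 0 ≤ᵐ[haarAddCircle] p) (A : EllTwo ≃ₗ[ℂ] EllTwo)
    (hA : IsMatrixOperator (fun k j : ℕ => fourierCoeff (fun t => (p t : ℂ)) ((k : ℤ) - j))
      A.toLinearMap) :
    ∃ c > 0, ∃ C > 0, ∀ᵐ t ∂(@haarAddCircle T _), c ≤ p t ∧ p t ≤ C := by
  have hsymm : A.toLinearMap.IsSymmetric := hA.isSymmetric fun k j => by
    rw [← fourierCoeff_ofReal_neg, neg_sub]
  have hnn : ∀ q : C(AddCircle T, ℂ), 0 ≤ ∫ t, p t * ‖q t‖ ^ 2 ∂haarAddCircle := fun q =>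
    integral_nonneg_of_ae (by filter_upwards [h0] with t ht using mul_nonneg ht (sq_nonneg _))
  have hpos : ∀ x, 0 ≤ (inner ℂ x (A x)).re := by
    intro x
    have hc : Continuous fun y : EllTwo => (inner ℂ y (A y)).re :=
      Complex.continuous_re.comp (continuous_id.inner hsymm.continuous)
    refine ge_of_tendsto' ((hc.tendsto x).comp (hasSum_single_one x)) fun s => ?_
    have h := hA.inner_sum_single hp s x id 0
    simp only [id] at h
    change 0 ≤ (inner ℂ _ (A.toLinearMap _)).re
    rw [h, Complex.ofReal_re]
    exact hnn _
  obtain ⟨c, hc, C, hC, hb⟩ := hsymm.exists_bounds A hpos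
  refine ⟨c, hc, C, hC, ?_⟩
  have hq : ∀ q ∈ Submodule.span ℂ (Set.range (@fourier T)),
      c * ∫ t, ‖q t‖ ^ 2 ∂haarAddCircle ≤ ∫ t, p t * ‖q t‖ ^ 2 ∂haarAddCircle ∧
        ∫ t, p t * ‖q t‖ ^ 2 ∂haarAddCircle ≤ C * ∫ t, ‖q t‖ ^ 2 ∂haarAddCircle := by
    intro q hq
    obtain ⟨s, b, n, N, rfl⟩ := exists_eq_sum_fourier hq
    have h := hb (∑ i ∈ s, b i • (lp.single 2 (n i) (1 : ℂ) : EllTwo))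
    have h2 := hA.inner_sum_single hp s b n N
    rw [LinearEquiv.coe_coe] at h2
    rwa [h2, norm_sum_single_sq (T := T) s b n N, Complex.ofReal_re] at h
  have hlo := ae_le_of_forall_integral_mul_sq_le (m := @haarAddCircle T _) (w₁ := fun _ => c)
    (integrable_const c) hp (Filter.Eventually.of_forall fun _ => hc.le) h0 fun q hq' => by
      rw [integral_const_mul]
      exact (hq q hq').1
  have hup := ae_le_of_forall_integral_mul_sq_le (m := @haarAddCircle T _) (w₂ := fun _ => C)
    hp (integrable_const C) h0 (Filter.Eventually.of_forall fun _ => hC.le) fun q hq' => by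
      rw [integral_const_mul]
      exact (hq q hq').2
  filter_upwards [hlo, hup] with t h1 h2 using ⟨h1, h2⟩

end ToeplitzBounds

section Multiplication

open AddCircle

variable {T : ℝ} [hT : Fact (0 < T)]

/-- `M` is the operator of multiplication by the real function `w` in `L²` of the circle. -/
def IsMultiplicationBy (w : AddCircle T → ℝ)
    (M : Lp ℂ 2 (@haarAddCircle T _) →L[ℂ] Lp ℂ 2 (@haarAddCircle T _)) : Prop :=
  ∀ φ : Lp ℂ 2 (@haarAddCircle T _), M φ =ᵐ[haarAddCircle] fun t => (w t : ℂ) * φ t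

theorem exists_isMultiplicationBy {w : AddCircle T → ℝ}
    (hw : AEStronglyMeasurable w (@haarAddCircle T _)) {C : ℝ}
    (hC : ∀ᵐ t ∂(@haarAddCircle T _), |w t| ≤ C) : ∃ M, IsMultiplicationBy w M := by
  have hmem : MemLp (fun t => (w t : ℂ)) ⊤ (@haarAddCircle T _) :=
    memLp_top_of_bound (Complex.continuous_ofReal.comp_aestronglyMeasurable hw) C (by simpa using hC)
  let W : Lp ℂ ⊤ (@haarAddCircle T _) := hmem.toLp _
  let M₀ : Lp ℂ 2 (@haarAddCircle T _) →ₗ[ℂ] Lp ℂ 2 (@haarAddCircle T _) :=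
    { toFun := fun φ => (W • φ : Lp ℂ 2 (@haarAddCircle T _))
      map_add' := fun x y => Lp.add_smul W x y
      map_smul' := fun c x => (Lp.smul_comm c W x).symm }
  refine ⟨M₀.mkContinuous ‖W‖ fun φ => Lp.norm_smul_le W φ, fun φ => ?_⟩
  have h : (W • φ : Lp ℂ 2 (@haarAddCircle T _)) =ᵐ[haarAddCircle] _ :=
    Lp.coeFn_lpSMul W φ
  filter_upwards [h, hmem.coeFn_toLp] with t h1 h2
  change (W • φ : Lp ℂ 2 (@haarAddCircle T _)) t = _
  rw [h1, Pi.smul_apply', h2, smul_eq_mul]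

namespace IsMultiplicationBy

variable {w w' w'' : AddCircle T → ℝ}
  {M M' M'' : Lp ℂ 2 (@haarAddCircle T _) →L[ℂ] Lp ℂ 2 (@haarAddCircle T _)}

theorem apply_apply (h : IsMultiplicationBy w M) (h' : IsMultiplicationBy w' M')
    (h'' : IsMultiplicationBy w'' M'') (hw : ∀ᵐ t ∂(@haarAddCircle T _), w t * w' t = w'' t)
    (φ : Lp ℂ 2 (@haarAddCircle T _)) : M (M' φ) = M'' φ := by
  refine Lp.ext ?_
  filter_upwards [h (M' φ), h' φ, h'' φ, hw] with t h1 h2 h3 h4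
  rw [h1, h2, h3, ← mul_assoc, ← Complex.ofReal_mul, h4]

theorem apply_apply_of_mul_eq_one (h : IsMultiplicationBy w M) (h' : IsMultiplicationBy w' M')
    (hw : ∀ᵐ t ∂(@haarAddCircle T _), w t * w' t = 1)
    (φ : Lp ℂ 2 (@haarAddCircle T _)) : M (M' φ) = φ :=
  h.apply_apply h' (w'' := fun _ => 1) (M'' := ContinuousLinearMap.id ℂ _)
    (fun φ => by simp) hw φ

theorem add_apply (h : IsMultiplicationBy w M) (h' : IsMultiplicationBy w' M')
    (h'' : IsMultiplicationBy w'' M'') (hw : ∀ᵐ t ∂(@haarAddCircle T _), w t + w' t = w'' t)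
    (φ : Lp ℂ 2 (@haarAddCircle T _)) : M φ + M' φ = M'' φ := by
  refine Lp.ext ?_
  filter_upwards [Lp.coeFn_add (M φ) (M' φ), h φ, h' φ, h'' φ, hw] with t h0 h1 h2 h3 h4
  rw [h0, Pi.add_apply, h1, h2, h3, ← add_mul, ← Complex.ofReal_add, h4]

theorem inner_left (h : IsMultiplicationBy w M) (φ ψ : Lp ℂ 2 (@haarAddCircle T _)) :
    inner ℂ (M φ) ψ = inner ℂ φ (M ψ) := by
  rw [L2.inner_def, L2.inner_def]
  refine integral_congr_ae ?_
  filter_upwards [h φ, h ψ] with t h1 h2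
  rw [h1, h2]
  simp only [RCLike.inner_apply, map_mul, Complex.conj_ofReal]
  ring

theorem inner_fourierBasis (h : IsMultiplicationBy w M) (m n : ℤ) :
    inner ℂ (fourierBasis (T := T) m) (M (fourierBasis n)) =
      fourierCoeff (fun t => (w t : ℂ)) (m - n) := by
  rw [L2.inner_def, fourierCoeff, coe_fourierBasis]
  refine integral_congr_ae ?_
  filter_upwards [h (fourierLp 2 n), coeFn_fourierLp (T := T) 2 n, coeFn_fourierLp (T := T) 2 m]
    with t h1 h2 h3
  rw [h1, h2, h3, neg_sub, sub_eq_add_neg, fourier_add, fourier_neg]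
  simp only [RCLike.inner_apply, smul_eq_mul]
  ring

end IsMultiplicationBy

end Multiplication

section GramOperator

/-- Summability is transported along a map of bounded Gram operator. -/
theorem summable_smul_of_gram {E F : Type*} [NormedAddCommGroup E] [InnerProductSpace ℂ E]
    [CompleteSpace E] [NormedAddCommGroup F] [InnerProductSpace ℂ F] [CompleteSpace F] {ι : Type*}
    {u : ι → F} {v : ι → E} {A : E →L[ℂ] E} (h : ∀ i j, inner ℂ (u i) (u j) = inner ℂ (v i) (A (v j)))
    {c : ι → ℂ} (hc : Summable fun i => c i • v i) : Summable fun i => c i • u i := by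
  have hle : ∀ s : Finset ι, ‖∑ i ∈ s, c i • u i‖ ^ 2 ≤ ‖A‖ * ‖∑ i ∈ s, c i • v i‖ ^ 2 := by
    intro s
    have h1 : inner ℂ (∑ i ∈ s, c i • u i) (∑ i ∈ s, c i • u i) =
        inner ℂ (∑ i ∈ s, c i • v i) (A (∑ i ∈ s, c i • v i)) := by
      simp only [map_sum, map_smul, sum_inner, inner_sum, inner_smul_left, inner_smul_right, h]
    calc ‖∑ i ∈ s, c i • u i‖ ^ 2
        = RCLike.re (inner ℂ (∑ i ∈ s, c i • v i) (A (∑ i ∈ s, c i • v i))) := by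
          rw [← h1, inner_self_eq_norm_sq]
      _ ≤ ‖∑ i ∈ s, c i • v i‖ * ‖A (∑ i ∈ s, c i • v i)‖ := re_inner_le_norm _ _
      _ ≤ ‖∑ i ∈ s, c i • v i‖ * (‖A‖ * ‖∑ i ∈ s, c i • v i‖) := by
          gcongr
          exact A.le_opNorm _
      _ = _ := by ring
  rw [summable_iff_vanishing_norm]
  intro ε hε
  obtain ⟨s, hs⟩ := summable_iff_vanishing_norm.1 hc (ε / (‖A‖ + 1)) (by positivity)
  refine ⟨s, fun t ht => ?_⟩
  have h2 := hs t ht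
  rw [lt_div_iff₀ (by positivity)] at h2
  refine lt_of_pow_lt_pow_left₀ 2 hε.le ((hle t).trans_lt ?_)
  have h3 : (‖∑ i ∈ t, c i • v i‖ * (‖A‖ + 1)) ^ 2 < ε ^ 2 := by gcongr
  nlinarith [norm_nonneg A, sq_nonneg ‖∑ i ∈ t, c i • v i‖,
    mul_nonneg (norm_nonneg A) (sq_nonneg ‖∑ i ∈ t, c i • v i‖),
    mul_nonneg (sq_nonneg ‖A‖) (sq_nonneg ‖∑ i ∈ t, c i • v i‖)]

end GramOperator

section Estimation

variable {E : Type*} [NormedAddCommGroup E] [InnerProductSpace ℂ E]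

theorem HilbertBasis.hasSum_nonpos (e : HilbertBasis ℤ ℂ E) {φ : E}
    (h : ∀ n : ℤ, 0 < n → inner ℂ (e n) φ = 0) :
    HasSum (fun k : ℕ => inner ℂ (e (-k)) φ • e (-k)) φ := by
  have h1 := e.hasSum_repr φ
  simp only [e.repr_apply_apply] at h1
  have hinj : Function.Injective fun k : ℕ => -(k : ℤ) := fun a b hab => by simpa using hab
  refine (Function.Injective.hasSum_iff (f := fun n : ℤ => inner ℂ (e n) φ • e n) hinj ?_).2 h1
  intro n hn
  have : 0 < n := by
    by_contra hneg
    exact hn ⟨n.natAbs, show -(n.natAbs : ℤ) = n by omega⟩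
  simp only [h n this, zero_smul]

variable [CompleteSpace E]

/-- The isometry of `ℓ²` into a Hilbert space which maps the standard basis to the elements of a
Hilbert basis selected by an injection. -/
noncomputable def HilbertBasis.embedding (e : HilbertBasis ℤ ℂ E) {n : ℕ → ℤ} (hn : Function.Injective n) :
    EllTwo →L[ℂ] E :=
  (e.orthonormal.comp n hn).orthogonalFamily.linearIsometry.toContinuousLinearMap

theorem HilbertBasis.hasSum_embedding (e : HilbertBasis ℤ ℂ E) {n : ℕ → ℤ}
    (hn : Function.Injective n) (x : EllTwo) :
    HasSum (fun k => x k • e (n k)) (e.embedding hn x) := by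
  have h := (e.orthonormal.comp n hn).orthogonalFamily.hasSum_linearIsometry x
  simp only [Function.comp_apply, LinearIsometry.toSpanSingleton_apply] at h
  exact h

theorem HilbertBasis.embedding_single (e : HilbertBasis ℤ ℂ E) {n : ℕ → ℤ}
    (hn : Function.Injective n) (k : ℕ) :
    e.embedding hn (lp.single 2 k (1 : ℂ)) = e (n k) := by
  have h := (e.orthonormal.comp n hn).orthogonalFamily.linearIsometry_apply_single
    (i := k) (1 : ℂ)
  rw [LinearIsometry.toSpanSingleton_apply, one_smul] at h
  exact h

theorem HilbertBasis.adjoint_embedding_apply (e : HilbertBasis ℤ ℂ E) {n : ℕ → ℤ}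
    (hn : Function.Injective n) (φ : E) (k : ℕ) :
    (e.embedding hn).adjoint φ k = inner ℂ (e (n k)) φ := by
  rw [← inner_single_one_left, ContinuousLinearMap.adjoint_inner_right, e.embedding_single]

theorem HilbertBasis.isMatrixOperator_compression (e : HilbertBasis ℤ ℂ E) {m n : ℕ → ℤ}
    (hm : Function.Injective m) (hn : Function.Injective n) (A : E →L[ℂ] E) :
    IsMatrixOperator (fun k l => inner ℂ (e (m k)) (A (e (n l))))
      ((e.embedding hm).adjoint ∘L A ∘L e.embedding hn).toLinearMap := by
  intro x k
  have h := ((innerSL ℂ (e (m k))).comp A).hasSum (e.hasSum_embedding hn x)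
  simp only [ContinuousLinearMap.comp_apply, innerSL_apply_apply, map_smul, smul_eq_mul] at h
  simp only [ContinuousLinearMap.coe_coe, ContinuousLinearMap.comp_apply,
    e.adjoint_embedding_apply]
  exact h.congr_fun fun l => mul_comm _ _

theorem IsMatrixOperator.unique {M : ℕ → ℕ → ℂ} {A B : EllTwo →ₗ[ℂ] EllTwo}
    (hA : IsMatrixOperator M A) (hB : IsMatrixOperator M B) : A = B :=
  LinearMap.ext fun x => lp.ext (funext fun k => (hA x k).unique (hB x k))

variable {F : Type*} [NormedAddCommGroup F] [InnerProductSpace ℂ F] [CompleteSpace F]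

/-- The projection of `X` on the past of `ζ` is represented by the element `φ` of the spectral
domain which solves the normal equations; the error is expressed through `φ`. -/
theorem hasSum_starProjection_past (e : HilbertBasis ℤ ℂ E) {A : E →L[ℂ] E}
    {ζ : ℤ → F} (hζ : ∀ m n, inner ℂ (ζ m) (ζ n) = inner ℂ (e m) (A (e n)))
    {X : F} {b φ : E} (hX : ∀ n, inner ℂ (ζ n) X = inner ℂ (e n) b)
    (hφ : ∀ n : ℤ, 0 < n → inner ℂ (e n) φ = 0)
    (hnormal : ∀ n : ℤ, n ≤ 0 → inner ℂ (e n) (A φ) = inner ℂ (e n) b)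
    (U : Submodule ℂ F) [U.HasOrthogonalProjection]
    (hU : U = (Submodule.span ℂ {Z | ∃ m : ℤ, m ≤ 0 ∧ Z = ζ m}).topologicalClosure) :
    HasSum (fun k : ℕ => inner ℂ (e (-k)) φ • ζ (-k)) (U.starProjection X) ∧
      ((‖X - U.starProjection X‖ ^ 2 : ℝ) : ℂ) = inner ℂ X X - inner ℂ b φ := by
  have hsum := e.hasSum_nonpos hφ
  obtain ⟨W, hW⟩ := summable_smul_of_gram (u := fun k : ℕ => ζ (-k))
    (v := fun k : ℕ => e (-k)) (fun i j => hζ _ _) hsum.summable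
  have hgen : ∀ m : ℤ, m ≤ 0 → ζ m ∈ U := fun m hm => by
    rw [hU]
    exact Submodule.le_topologicalClosure _ (Submodule.subset_span ⟨m, hm, rfl⟩)
  have hclosed : IsClosed (U : Set F) := by
    rw [hU]
    exact Submodule.isClosed_topologicalClosure _
  have hWU : W ∈ U := hclosed.mem_of_tendsto hW (Filter.Eventually.of_forall fun s =>
    U.sum_mem fun k _ => U.smul_mem _ (hgen _ (by simp)))
  have hinnerW : ∀ n, inner ℂ (ζ n) W = inner ℂ (e n) (A φ) := by
    intro n
    have h1 := (innerSL ℂ (ζ n)).hasSum hW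
    have h2 := ((innerSL ℂ (e n)).comp A).hasSum hsum
    refine h1.unique (h2.congr_fun fun k => ?_)
    simp only [ContinuousLinearMap.comp_apply, map_smul, innerSL_apply_apply, hζ]
  have horth : ∀ u ∈ U, inner ℂ u (X - W) = 0 := by
    have hle : U ≤ (ℂ ∙ (X - W))ᗮ := by
      rw [hU]
      refine Submodule.topologicalClosure_minimal _ (Submodule.span_le.2 ?_)
        (Submodule.isClosed_orthogonal _)
      rintro _ ⟨m, hm, rfl⟩
      rw [SetLike.mem_coe, Submodule.mem_orthogonal_singleton_iff_inner_left, inner_sub_right,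
        hX, hinnerW, hnormal m hm, sub_self]
    exact fun u hu => Submodule.mem_orthogonal_singleton_iff_inner_left.1 (hle hu)
  have hproj : U.starProjection X = W :=
    Submodule.eq_starProjection_of_mem_of_inner_eq_zero hWU fun u hu => by
      rw [← inner_conj_symm, horth u hu, map_zero]
  have hXW : inner ℂ X W = inner ℂ b φ := by
    have h1 := (innerSL ℂ X).hasSum hW
    have h2 := (innerSL ℂ b).hasSum hsum
    refine h1.unique (h2.congr_fun fun k => ?_)
    simp only [map_smul, innerSL_apply_apply]
    rw [← inner_conj_symm X, hX, inner_conj_symm]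
  rw [hproj]
  refine ⟨hW, ?_⟩
  have h3 : inner ℂ (X - W) (X - W) = inner ℂ X (X - W) := by
    rw [inner_sub_left, horth W hWU, sub_zero]
  rw [← hXW, ← inner_sub_right, ← h3, inner_self_eq_norm_sq_to_K, Complex.ofReal_pow]
  rfl

theorem LinearMap.IsSymmetric.hasSum_quadraticForm {V : EllTwo →ₗ[ℂ] EllTwo} (hV : V.IsSymmetric)
    (x : EllTwo) :
    (∀ j, HasSum (fun k => starRingEnd ℂ (matrixElement V k j) * starRingEnd ℂ (x j) * x k)
      (starRingEnd ℂ (x j) * V x j)) ∧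
    HasSum (fun j => starRingEnd ℂ (x j) * V x j) (inner ℂ x (V x)) := by
  refine ⟨fun j => ?_, (lp.hasSum_inner x (V x)).congr_fun fun j => ?_⟩
  · rw [← inner_single_one_left j (V x), ← hV]
    have h := (lp.hasSum_inner (V (lp.single 2 j (1 : ℂ))) x).mul_left (starRingEnd ℂ (x j))
    refine h.congr_fun fun k => ?_
    rw [matrixElement, RCLike.inner_apply]
    ring
  · rw [RCLike.inner_apply, mul_comm]

end Estimation

section SpectralTransfer

open AddCircle

instance fact_two_pi_pos : Fact (0 < Real.pi - -Real.pi) := ⟨by linarith [Real.pi_pos]⟩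

/-- The circle of length `2π`, as it appears in Mathlib's Fourier coefficients on `[-π, π]`. -/
abbrev SpectralCircle : Type := AddCircle (Real.pi - -Real.pi)

/-- The representative in `(-π, π]` of a point of the circle. -/
noncomputable def spectralAngle (x : SpectralCircle) : ℝ :=
  (equivIoc (Real.pi - -Real.pi) (-Real.pi) x : ℝ)

theorem fourierCoef_eq_fourierCoeff (φ : ℝ → ℝ) (n : ℤ) :
    fourierCoef φ n = fourierCoeff (fun x : SpectralCircle => (φ (spectralAngle x) : ℂ)) n :=
  fourierCoef_eq_fourierCoeffOn φ n

theorem measurePreserving_spectralAngle :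
    MeasurePreserving spectralAngle (haarAddCircle : Measure SpectralCircle)
      ((ENNReal.ofReal (Real.pi - -Real.pi))⁻¹ •
        volume.restrict (Set.Ico (-Real.pi) Real.pi)) := by
  have h : MeasurePreserving spectralAngle (volume : Measure SpectralCircle)
      (volume.restrict (Set.Ioc (-Real.pi) (-Real.pi + (Real.pi - -Real.pi)))) :=
    (measurePreserving_subtype_coe measurableSet_Ioc).comp
      (measurePreserving_equivIoc (Real.pi - -Real.pi))
  rw [add_sub_cancel, Measure.restrict_congr_set Ico_ae_eq_Ioc.symm] at h
  have h2 := h.smul_measure (ENNReal.ofReal (Real.pi - -Real.pi))⁻¹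
  rw [volume_eq_smul_haarAddCircle, smul_smul, ENNReal.inv_mul_cancel, one_smul] at h2
  · exact h2
  · simpa using Real.pi_pos
  · exact ENNReal.ofReal_ne_top

theorem ae_comp_spectralAngle {Q : ℝ → Prop}
    (h : ∀ᵐ t ∂(volume.restrict (Set.Ico (-Real.pi) Real.pi)), Q t) :
    ∀ᵐ x ∂(haarAddCircle : Measure SpectralCircle), Q (spectralAngle x) :=
  measurePreserving_spectralAngle.quasiMeasurePreserving.ae
    (Measure.ae_smul_measure h _)

theorem integrable_comp_spectralAngle {φ : ℝ → ℝ}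
    (h : IntegrableOn φ (Set.Ico (-Real.pi) Real.pi)) :
    Integrable (fun x => φ (spectralAngle x)) (haarAddCircle : Measure SpectralCircle) :=
  measurePreserving_spectralAngle.integrable_comp_of_integrable
    (Integrable.smul_measure h (by simpa using Real.pi_pos))

theorem MinimalityCondition.ae_pos {f g : ℝ → ℝ} (h : MinimalityCondition f g)
    (hm : AEMeasurable (fun t => f t + g t) (volume.restrict (Set.Ico (-Real.pi) Real.pi))) :
    ∀ᵐ t ∂(volume.restrict (Set.Ico (-Real.pi) Real.pi)), 0 < f t + g t := by
  filter_upwards [ae_lt_top' hm.ennreal_ofReal.inv h.ne] with t ht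
  rwa [Pi.inv_apply, ENNReal.inv_lt_top, ENNReal.ofReal_pos] at ht

theorem MinimalityCondition.integrableOn {f g : ℝ → ℝ} (h : MinimalityCondition f g)
    (hm : AEMeasurable (fun t => f t + g t) (volume.restrict (Set.Ico (-Real.pi) Real.pi))) :
    IntegrableOn (fun t => 1 / (f t + g t)) (Set.Ico (-Real.pi) Real.pi) := by
  refine ⟨(hm.const_div 1).aestronglyMeasurable, ?_⟩
  refine lt_of_le_of_lt (le_of_eq ?_) h
  refine lintegral_congr_ae ?_
  filter_upwards [h.ae_pos hm] with t ht
  rw [Real.enorm_eq_ofReal (by positivity), one_div, ENNReal.ofReal_inv_of_pos ht]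

variable {Ω : Type*} [MeasurableSpace Ω] {μ : Measure Ω}

theorem inner_Lp_eq_integral (X Y : Lp ℂ 2 μ) :
    inner ℂ X Y = ∫ ω, Y ω * starRingEnd ℂ (X ω) ∂μ := by
  rw [L2.inner_def]
  rfl

theorem IsStationaryWithDensity.inner_eq {ξ : ℤ → Lp ℂ 2 μ} {f : ℝ → ℝ}
    (hξ : IsStationaryWithDensity ξ f) (m n : ℤ) :
    inner ℂ (ξ m) (ξ n) = fourierCoef f (m - n) := by
  rw [inner_Lp_eq_integral, hξ.covariance, fourierCoef]
  congr 1
  refine intervalIntegral.integral_congr fun t _ => ?_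
  congr 2
  push_cast
  ring

theorem AreUncorrelated.inner_left {ξ η : ℤ → Lp ℂ 2 μ} (h : AreUncorrelated ξ η) (m n : ℤ) :
    inner ℂ (η m) (ξ n) = 0 := by
  rw [inner_Lp_eq_integral, h]

theorem AreUncorrelated.inner_right {ξ η : ℤ → Lp ℂ 2 μ} (h : AreUncorrelated ξ η) (m n : ℤ) :
    inner ℂ (ξ m) (η n) = 0 := by
  rw [← inner_conj_symm, h.inner_left, map_zero]

theorem meanSquareError_eq (Z W : Lp ℂ 2 μ) : meanSquareError Z W = ‖Z - W‖ ^ 2 := by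
  have h := inner_self_eq_norm_sq_to_K (𝕜 := ℂ) (Z - W)
  rw [L2.inner_def] at h
  have h2 : ∫ ω, inner ℂ ((Z - W) ω) ((Z - W) ω) ∂μ = ∫ ω, ((‖Z ω - W ω‖ ^ 2 : ℝ) : ℂ) ∂μ := by
    refine integral_congr_ae ?_
    filter_upwards [Lp.coeFn_sub Z W] with ω hω
    rw [hω, inner_self_eq_norm_sq_to_K, Complex.ofReal_pow]
    rfl
  rw [h2, integral_complex_ofReal] at h
  exact Complex.ofReal_injective (h.trans (Complex.ofReal_pow _ _).symm)

end SpectralTransfer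

theorem mainTheorem4 {Ω : Type*} [MeasurableSpace Ω] (μ : Measure Ω) [IsProbabilityMeasure μ]
    (ξ η : ℤ → Lp ℂ 2 μ) (f g : ℝ → ℝ)
    (hξ : IsStationaryWithDensity ξ f) (hη : IsStationaryWithDensity η g)
    (hξη : AreUncorrelated ξ η) (hmin : MinimalityCondition f g)
    -- the matrix `(P_{k,j})_{k,j ≥ 0}` defines an invertible linear operator in `ℓ²`;
    -- its inverse is `V = P.symm`
    (P : EllTwo ≃ₗ[ℂ] EllTwo)
    (hP : IsMatrixOperator (fun k j : ℕ => coefP f g k j) P.toLinearMap) :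
    -- the vector `r₀ = (r(1), r(2), …)` and the operator `Y = (P_{-k,l+1})_{k,l ≥ 0}` live in `ℓ²`,
    -- and `V` is given by its matrix
    ∃ (r₀ : EllTwo) (Y : EllTwo →ₗ[ℂ] EllTwo),
      (∀ l : ℕ, r₀ l = coefR f g (l + 1)) ∧
      IsMatrixOperator (fun k l : ℕ => coefP f g (-k) (l + 1)) Y ∧
      IsMatrixOperator (matrixElement P.symm.toLinearMap) P.symm.toLinearMap ∧
      -- the optimal estimate of `ξ(0)`, as a series converging in mean square
      HasSum
        (fun k : ℕ => ((starRingEnd ℂ) (coefR f g k) - Y (P.symm r₀) k) • (ξ (-k) + η (-k)))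
        (optimalEstimate ξ η (ξ 0)) ∧
      -- the mean-square error
      (∀ j : ℕ, Summable fun k : ℕ =>
        (starRingEnd ℂ) (matrixElement P.symm.toLinearMap k j) *
          (starRingEnd ℂ) (coefR f g (j + 1)) * coefR f g (k + 1)) ∧
      (Summable fun j : ℕ => ∑' k : ℕ,
        (starRingEnd ℂ) (matrixElement P.symm.toLinearMap k j) *
          (starRingEnd ℂ) (coefR f g (j + 1)) * coefR f g (k + 1)) ∧
      (Summable fun l : ℤ => coefR f g l * fourierCoef g (-l)) ∧
      (meanSquareError (ξ 0) (optimalEstimate ξ η (ξ 0)) : ℂ) =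
        (∑' j : ℕ, ∑' k : ℕ,
          (starRingEnd ℂ) (matrixElement P.symm.toLinearMap k j) *
            (starRingEnd ℂ) (coefR f g (j + 1)) * coefR f g (k + 1)) +
        ∑' l : ℤ, coefR f g l * fourierCoef g (-l) := by
  have hF := integrable_comp_spectralAngle hξ.integrable
  have hG := integrable_comp_spectralAngle hη.integrable
  have hF0 := ae_comp_spectralAngle hξ.nonneg
  have hG0 := ae_comp_spectralAngle hη.nonneg
  have hm : AEMeasurable (fun t => f t + g t)
      (volume.restrict (Set.Ico (-Real.pi) Real.pi)) :=
    hξ.integrable.aemeasurable.add hη.integrable.aemeasurable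
  have hH0 := ae_comp_spectralAngle (hmin.ae_pos hm)
  have hp := integrable_comp_spectralAngle (hmin.integrableOn hm)
  have hsymm : P.toLinearMap.IsSymmetric := hP.isSymmetric fun k j => by
    simp only [coefP, fourierCoef_eq_fourierCoeff]
    rw [← fourierCoeff_ofReal_neg, neg_sub]
  have hVsymm := LinearMap.IsSymmetric.symm P hsymm
  obtain ⟨c, hc, C, hC, hpb⟩ := IsMatrixOperator.toeplitz_symbol_bounds hp
    (by filter_upwards [hH0] with x hx using (one_div_pos.2 hx).le) P
    (by simpa only [coefP, fourierCoef_eq_fourierCoeff] using hP)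
  have hHb : ∀ᵐ x ∂AddCircle.haarAddCircle,
      f (spectralAngle x) + g (spectralAngle x) ≤ 1 / c := by
    filter_upwards [hpb, hH0] with x hx hx0
    rw [le_one_div hx0 hc]
    exact hx.1
  obtain ⟨Mf, hMf⟩ := exists_isMultiplicationBy (C := 1 / c) hF.aestronglyMeasurable (by
    filter_upwards [hF0, hG0, hHb] with x h1 h2 h3
    rw [abs_of_nonneg h1]
    linarith)
  obtain ⟨Mg, hMg⟩ := exists_isMultiplicationBy (C := 1 / c) hG.aestronglyMeasurable (by
    filter_upwards [hF0, hG0, hHb] with x h1 h2 h3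
    rw [abs_of_nonneg h2]
    linarith)
  obtain ⟨Mh, hMh⟩ := exists_isMultiplicationBy (C := 1 / c) (hF.add hG).aestronglyMeasurable (by
    filter_upwards [hH0, hHb] with x h1 h2
    rw [Pi.add_apply, abs_of_pos h1]
    exact h2)
  obtain ⟨Mp, hMp⟩ := exists_isMultiplicationBy (C := C) hp.aestronglyMeasurable (by
    filter_upwards [hH0, hpb] with x h1 h2
    rw [abs_of_pos (one_div_pos.2 h1)]
    exact h2.2)
  obtain ⟨Mr, hMr⟩ := exists_isMultiplicationBy
    (w := fun x => f (spectralAngle x) / (f (spectralAngle x) + g (spectralAngle x))) (C := 1)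
    (hF.aemeasurable.div (hF.add hG).aemeasurable).aestronglyMeasurable (by
      filter_upwards [hH0, hF0, hG0] with x h1 h2 h3
      rw [abs_of_nonneg (div_nonneg h2 h1.le), div_le_one h1]
      linarith)
  set e := fourierBasis (T := Real.pi - -Real.pi) with he
  have hr : ∀ n : ℤ, coefR f g n = inner ℂ (e n) (Mr (e 0)) := fun n => by
    rw [hMr.inner_fourierBasis, sub_zero, coefR, fourierCoef_eq_fourierCoeff]
  have hcoefP : ∀ m n : ℤ, coefP f g m n = inner ℂ (e m) (Mp (e n)) := fun m n => by
    rw [hMp.inner_fourierBasis, coefP, fourierCoef_eq_fourierCoeff]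
  have hf : ∀ m n : ℤ, fourierCoef f (m - n) = inner ℂ (e m) (Mf (e n)) := fun m n => by
    rw [hMf.inner_fourierBasis, fourierCoef_eq_fourierCoeff]
  have hg : ∀ m n : ℤ, fourierCoef g (m - n) = inner ℂ (e m) (Mg (e n)) := fun m n => by
    rw [hMg.inner_fourierBasis, fourierCoef_eq_fourierCoeff]
  have hpf : ∀ φ, Mp (Mf φ) = Mr φ := hMp.apply_apply hMf hMr
    (Filter.Eventually.of_forall fun x => one_div_mul_eq_div _ _)
  have hhp : ∀ φ, Mh (Mp φ) = φ := hMh.apply_apply_of_mul_eq_one hMp (by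
    filter_upwards [hH0] with x hx
    exact mul_one_div_cancel hx.ne')
  have hfgh : ∀ φ, Mf φ + Mg φ = Mh φ := hMf.add_apply hMg hMh
    (Filter.Eventually.of_forall fun x => rfl)
  have hinjS : Function.Injective fun k : ℕ => (k : ℤ) + 1 := fun a b hab => by simpa using hab
  have hinjN : Function.Injective fun k : ℕ => -(k : ℤ) := fun a b hab => by simpa using hab
  set J := e.embedding hinjS with hJ
  set r₀ : EllTwo := J.adjoint (Mr (e 0)) with hr₀
  have hr₀_apply : ∀ l : ℕ, r₀ l = coefR f g (l + 1) := fun l => by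
    rw [hr, hr₀, hJ, e.adjoint_embedding_apply]
  let Y : EllTwo →ₗ[ℂ] EllTwo :=
    ((e.embedding hinjN).adjoint ∘L Mp ∘L J).toLinearMap
  have hY : IsMatrixOperator (fun k l : ℕ => coefP f g (-k) (l + 1)) Y := by
    simp only [hcoefP]
    exact e.isMatrixOperator_compression hinjN hinjS Mp
  have hPeq : P.toLinearMap = (J.adjoint ∘L Mp ∘L J).toLinearMap := by
    refine hP.unique ?_
    have h := e.isMatrixOperator_compression hinjS hinjS Mp
    simpa only [← hcoefP, coefP, add_sub_add_right_eq_sub] using h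
  set v : EllTwo := P.symm r₀ with hv
  have hPv : J.adjoint (Mp (J v)) = r₀ := by
    have h := LinearMap.congr_fun hPeq v
    rw [LinearEquiv.coe_coe, hv, P.apply_symm_apply] at h
    exact h.symm
  set φ := Mr (e 0) - Mp (J v) with hφ
  have hφpos : ∀ n : ℤ, 0 < n → inner ℂ (e n) φ = 0 := by
    intro n hn
    obtain ⟨k, rfl⟩ : ∃ k : ℕ, n = k + 1 := ⟨(n - 1).toNat, by omega⟩
    rw [hφ, ← e.adjoint_embedding_apply hinjS, map_sub, ← hJ, hPv, sub_self]
    rfl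
  have hφcoef : ∀ k : ℕ, inner ℂ (e (-k)) φ = starRingEnd ℂ (coefR f g k) - Y v k := by
    intro k
    rw [hφ, inner_sub_right, ← hr]
    congr 1
    · simp only [coefR, fourierCoef_eq_fourierCoeff]
      exact fourierCoeff_ofReal_neg _ _
    · exact (e.adjoint_embedding_apply hinjN _ _).symm
  have hMhφ : Mh φ = Mf (e 0) - J v := by
    rw [hφ, map_sub, hhp, ← hpf, hhp]
  have hJv : ∀ n : ℤ, n ≤ 0 → inner ℂ (e n) (J v) = 0 := by
    intro n hn
    have h := (innerSL ℂ (e n)).hasSum (e.hasSum_embedding hinjS v)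
    refine h.unique (hasSum_zero.congr_fun fun k => ?_)
    rw [map_smul, innerSL_apply_apply, e.orthonormal.inner_eq_zero (by omega), smul_zero]
  have hest := hasSum_starProjection_past e (A := Mh) (ζ := fun m => ξ m + η m) (X := ξ 0)
    (b := Mf (e 0)) (φ := φ)
    (fun m n => by
      rw [inner_add_left, inner_add_right, inner_add_right, hξη.inner_left, hξη.inner_right,
        hξ.inner_eq, hη.inner_eq, hf, hg, ← hfgh, inner_add_right, add_zero, zero_add])
    (fun n => by
      rw [inner_add_left, hξη.inner_left, hξ.inner_eq, hf, add_zero])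
    hφpos (fun n hn => by rw [hMhφ, inner_sub_right, hJv n hn, sub_zero])
    (observedSpace ξ η) rfl
  obtain ⟨hsum, herr⟩ := hest
  obtain ⟨hin, hout⟩ := hVsymm.hasSum_quadraticForm r₀
  simp only [hr₀_apply] at hin
  have hin' : ∀ j : ℕ, ∑' k : ℕ, (starRingEnd ℂ) (matrixElement P.symm.toLinearMap k j) *
      (starRingEnd ℂ) (coefR f g (j + 1)) * coefR f g (k + 1) =
        starRingEnd ℂ (r₀ j) * P.symm.toLinearMap r₀ j := fun j => by
    rw [(hin j).tsum_eq, hr₀_apply]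
  have hnoise : HasSum (fun l : ℤ => coefR f g l * fourierCoef g (-l))
      (inner ℂ (Mg (e 0)) (Mr (e 0))) := by
    refine (e.hasSum_inner_mul_inner (Mg (e 0)) (Mr (e 0))).congr_fun fun l => ?_
    rw [hMg.inner_left, ← zero_sub l, hg, hr, mul_comm]
  refine ⟨r₀, Y, hr₀_apply, hY, hVsymm.isMatrixOperator_matrixElement, ?_,
    fun j => (hin j).summable, ?_, hnoise.summable, ?_⟩
  · simp only [hφcoef] at hsum
    exact hsum
  · simp only [hin']
    exact hout.summable
  · simp only [hin']
    rw [hout.tsum_eq, hnoise.tsum_eq, meanSquareError_eq, optimalEstimate, herr, hξ.inner_eq, hf,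
      hφ, inner_sub_right, ← hMp.inner_left, hpf, hr₀, ContinuousLinearMap.adjoint_inner_left]
    have h1 : inner ℂ (e 0) (Mf (e 0)) =
        inner ℂ (Mf (e 0)) (Mr (e 0)) + inner ℂ (Mg (e 0)) (Mr (e 0)) := by
      rw [← inner_add_left, hfgh, hMh.inner_left, ← hpf, hhp]
    rw [h1]
    change _ = inner ℂ (Mr (e 0)) (J v) + _
    ring
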